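/- Let $\Bbbk$ be a field and let $G$ be a finite simple graph with a clique partition $\pi=\{W_1,\dots,W_r\}$, that is, $V(G)$ is the disjoint union of the nonempty sets $W_1,\dots,W_r$, each of which is a clique of $G$. Let $G^{\pi}$ be the clique-whiskered graph, obtained from $G$ by adding new vertices $w_1,\dots,w_r$ and joining $w_i$ to exactly the vertices of $W_i$ for $i=1,\dots,r$. Let $S$ be the polynomial ring over $\Bbbk$ whose variables are the vertices of $G^{\pi}$, and let $I(G^{\pi})\subset S$ be the edge ideal, generated by the products $xy$ for the edges $\{x,y\}$ of $G^{\pi}$. Then $R=S/I(G^{\pi})$ is Cohen–Macaulay, that is, $\operatorname{depth}R=\dim R$, and its Cohen–Macaulay type equals the number of minimal (with respect to inclusion) vertex covers of $G$: $$\operatorname{type}(S/I(G^{\pi}))=|\{C : C\text{ is a minimal vertex cover of }G\}|.$$ Here $\mathfrak m$ is the ideal of $R$ generated by the residue classes of the variables, $\operatorname{depth}R$ is the maximal length of an $R$-regular sequence in $\mathfrak m$, and $\operatorname{type}(R)=\dim_{\Bbbk}\operatorname{Ext}_R^{t}(R/\mathfrak m,R)$ with $t=\operatorname{depth}R$. 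-/

import Mathlib

open CategoryTheory

universe u

/-- `π` is a clique partition of `G`: a partition of the vertex set into (nonempty) cliques. -/
def IsCliquePartition {V : Type*} (G : SimpleGraph V) (π : Set (Set V)) : Prop :=
  Setoid.IsPartition π ∧ ∀ W ∈ π, G.IsClique W

/-- The clique-whiskered graph `G^π`: to `G` one adds one new vertex `Sum.inr W` for each block
`W ∈ π`, joined to exactly the vertices of `W`. -/
def cliqueWhiskered {V : Type*} (G : SimpleGraph V) (π : Set (Set V)) : SimpleGraph (V ⊕ π) where
  Adj
    | Sum.inl x, Sum.inl y => G.Adj x y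
    | Sum.inl x, Sum.inr W => x ∈ W.1
    | Sum.inr W, Sum.inl x => x ∈ W.1
    | Sum.inr _, Sum.inr _ => False
  symm := ⟨by
    rintro (x | W) (y | W') h
    · exact SimpleGraph.Adj.symm (G := G) h
    · exact h
    · exact h
    · exact h⟩
  loopless := ⟨by
    rintro (x | W) h
    · exact SimpleGraph.irrefl (G := G) h
    · exact h⟩

/-- The edge ideal `I(G)` in the polynomial ring whose variables are the vertices of `G`. -/
noncomputable def edgeIdeal (k : Type*) [Field k] {V : Type*} (G : SimpleGraph V) :
    Ideal (MvPolynomial V k) :=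
  Ideal.span {f | ∃ x y : V, G.Adj x y ∧ f = MvPolynomial.X x * MvPolynomial.X y}

/-- The residue ring `k[V] / I(G)`. -/
abbrev EdgeRing (k : Type*) [Field k] {V : Type*} (G : SimpleGraph V) : Type _ :=
  MvPolynomial V k ⧸ edgeIdeal k G

/-- The homogeneous maximal ideal of `k[V] / I(G)`, generated by the classes of the variables. -/
noncomputable def edgeRingMaximalIdeal (k : Type*) [Field k] {V : Type*} (G : SimpleGraph V) :
    Ideal (EdgeRing k G) :=
  Ideal.span (Set.range fun x : V => Ideal.Quotient.mk (edgeIdeal k G) (MvPolynomial.X x))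

/-- The depth of `R` with respect to `𝔪`: the supremum of the lengths of the `R`-regular sequences
all of whose members lie in `𝔪`. -/
noncomputable def depthAt {R : Type*} [CommRing R] (𝔪 : Ideal R) : ℕ∞ :=
  ⨆ rs ∈ {rs : List R | (∀ a ∈ rs, a ∈ 𝔪) ∧ RingTheory.Sequence.IsRegular R rs},
    (rs.length : ℕ∞)

/-- For a finitely generated positively graded `k`-algebra `R` with `R₀ = k` and homogeneous
maximal ideal `𝔪`: `R` is Cohen-Macaulay, that is, its depth equals its Krull dimension. -/
def IsGradedCohenMacaulay {R : Type*} [CommRing R] (𝔪 : Ideal R) : Prop :=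
  ringKrullDim R = (depthAt 𝔪 : WithBot ℕ∞)

/-- For a finitely generated positively graded `k`-algebra `R` with `R₀ = k` and homogeneous
maximal ideal `𝔪` (so that `R ⧸ 𝔪 = k`): the type `dim_k Ext_R^t(R ⧸ 𝔪, R)`, `t = depth R`. -/
noncomputable def cohenMacaulayType (k : Type*) [Field k] {R : Type u} [CommRing R] [Algebra k R]
    (𝔪 : Ideal R) : ℕ :=
  Module.finrank k
    (Abelian.Ext (ModuleCat.of.{u} R (R ⧸ 𝔪)) (ModuleCat.of.{u} R R) (depthAt 𝔪).toNat)

/-! Let `R` be the edge ring and `P` the polynomial ring with one variable per block, acting on `R`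
through the block sums `θ_W = w_W + ∑_{v ∈ W} x_v`. Since `W ∪ {w_W}` is a clique, `x_v θ_W = x_v²`
for `v ∈ W`, so non-squarefree monomials reduce and `R` is spanned over `P` by the monomials `x_S`,
`S` independent in `G` (`span_vertexMonomial`). Projections to the facets of the independence
complex show that these are independent (`linearIndependent_vertexMonomial`).

So `R` is free of finite rank over `P`: its dimension is the number of blocks and the `θ_W` form a
regular sequence of that length. Rees' shift turns `Ext` in this degree into the socle of `R/(θ)`.
There the `x_S` are a `k`-basis and `x_v x_S` is `x_{S ∪ {v}}` or `0`, so the socle is spanned by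
the `x_S` with `S` maximal (`forall_mul_mem_ofList_blockSumList_iff`). It is nonzero, which fixes
the depth, and complements turn maximal independent sets into minimal vertex covers. -/

open Abelian RingTheory.Sequence

/-! ### Ext and regular sequences. -/

/-- Rees' isomorphism: an element `x` that is regular on `M` and kills `N` shifts `Ext` by one,
provided that the lower `Ext` group vanishes. -/
theorem ModuleCat.finrank_ext_succ_of_isSMulRegular (k : Type*) [Field k] {R : Type u} [CommRing R]
    [Linear k (ModuleCat.{u} R)] (N M : ModuleCat.{u} R) (x : R)
    (hx : IsSMulRegular M x) (hN : x ∈ Module.annihilator R N) (n : ℕ)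
    (h : Subsingleton (Ext N M n)) :
    Module.finrank k (Ext N (ModuleCat.of R (QuotSMulTop x M)) n) =
      Module.finrank k (Ext N M (n + 1)) := by
  have hS := hx.smulShortComplex_shortExact
  refine LinearEquiv.finrank_eq (LinearEquiv.ofBijective
    (Ext.postcompOfLinear hS.extClass k N (rfl : n + 1 = n + 1)) ⟨?_, ?_⟩)
  -- The kernel of the connecting map comes from `Ext N M n`, which vanishes.
  · rw [← LinearMap.ker_eq_bot, LinearMap.ker_eq_bot']
    intro e he
    obtain ⟨e', rfl⟩ := Ext.covariant_sequence_exact₃ N hS e rfl he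
    have : e' = 0 := @Subsingleton.elim (Ext N M n) h _ _
    rw [this, Ext.zero_comp]
  -- Multiplication by `x` is zero on `Ext N M (n + 1)`, so every class comes from the connecting
  -- map.
  · intro e
    obtain ⟨e', he'⟩ := Ext.covariant_sequence_exact₁ N hS e (by
      have := Ext.postcomp_smul_id_eq_zero_of_mem_annihilator (M := M) hN (n + 1)
      exact congr($this e)) (rfl : n + 1 = n + 1)
    exact ⟨e', he'⟩

/-- Multiplication by `x` on `M` induces zero on `Ext N M i`, yet it is injective for `i = 0`; for
larger `i` the group is a quotient of `Ext` into `M/xM` one degree lower. -/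
theorem ModuleCat.subsingleton_ext_of_isWeaklyRegular {R : Type u} [CommRing R]
    (N : ModuleCat.{u} R) (rs : List R) (M : ModuleCat.{u} R)
    (hN : ∀ x ∈ rs, x ∈ Module.annihilator R N) (hM : IsWeaklyRegular M rs) (i : ℕ)
    (hi : i < rs.length) : Subsingleton (Ext N M i) := by
  induction rs generalizing M i with
  | nil => simp at hi
  | cons x rs ih =>
    rw [isWeaklyRegular_cons_iff] at hM
    have hS := hM.1.smulShortComplex_shortExact
    have hx := hN x (by simp)
    have h0 (i : ℕ) (e : Ext N M i) :
        e.comp (Ext.mk₀ (M.smulShortComplex x).f) (add_zero i) = 0 := by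
      have := Ext.postcomp_smul_id_eq_zero_of_mem_annihilator (M := M) hx i
      exact congr($this e)
    refine subsingleton_of_forall_eq 0 fun e => ?_
    cases i with
    | zero =>
      have := hS.mono_f
      exact Ext.postcomp_mk₀_injective_of_mono N (M.smulShortComplex x).f
        ((h0 0 e).trans (map_zero _).symm)
    | succ i =>
      obtain ⟨e', rfl⟩ := Ext.covariant_sequence_exact₁ N hS e (h0 _ e) rfl
      have := ih (ModuleCat.of R (QuotSMulTop x M)) (fun y hy => hN y (by simp [hy])) hM.2 i
        (by simpa using hi)
      have : e' = 0 := @Subsingleton.elim (Ext N (ModuleCat.of R (QuotSMulTop x M)) i) this _ _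
      rw [this, Ext.zero_comp]
      rfl

theorem ModuleCat.finrank_ext_length_of_isWeaklyRegular (k : Type*) [Field k] {R : Type u}
    [CommRing R] [Linear k (ModuleCat.{u} R)] (N : ModuleCat.{u} R) (rs : List R)
    (M : ModuleCat.{u} R) (hN : ∀ x ∈ rs, x ∈ Module.annihilator R N)
    (hM : IsWeaklyRegular M rs) :
    Module.finrank k (Ext N M rs.length) =
      Module.finrank k
        (N ⟶ ModuleCat.of R (M ⧸ (Ideal.ofList rs • ⊤ : Submodule R M))) := by
  induction rs generalizing M with
  | nil =>
    rw [List.length_nil, (Ext.linearEquiv₀ (R := k)).finrank_eq]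
    refine (Linear.homCongr k (Iso.refl N)
      (Submodule.quotEquivOfEqBot _ ?_).toModuleIso.symm).finrank_eq
    simp
  | cons x rs ih =>
    have hsub := ModuleCat.subsingleton_ext_of_isWeaklyRegular N _ M hN hM
    rw [isWeaklyRegular_cons_iff] at hM
    rw [List.length_cons, ← ModuleCat.finrank_ext_succ_of_isSMulRegular k N M x hM.1
      (hN x (by simp)) _ (hsub _ (by simp)),
      ih (ModuleCat.of R (QuotSMulTop x M)) (fun y hy => hN y (by simp [hy])) hM.2]
    exact (Linear.homCongr k (Iso.refl N)
      (Submodule.quotOfListConsSMulTopEquivQuotSMulTopInner M x rs).toModuleIso.symm).finrank_eq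

/-- If the regular sequence `rs` in `𝔪` is such that `Ext` of degree `rs.length` is nonzero, then
`rs` is as long as possible. -/
theorem depthAt_eq_length {R : Type u} [CommRing R] (𝔪 : Ideal R) (rs : List R)
    (hmem : ∀ a ∈ rs, a ∈ 𝔪) (hreg : IsRegular R rs)
    (hext : Nontrivial (Ext (ModuleCat.of.{u} R (R ⧸ 𝔪)) (ModuleCat.of.{u} R R) rs.length)) :
    depthAt 𝔪 = rs.length := by
  refine le_antisymm (iSup₂_le fun rs' h => ?_) (le_iSup₂_of_le rs ⟨hmem, hreg⟩ le_rfl)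
  -- A longer regular sequence would force `Ext` to vanish in degree `rs.length`.
  by_contra! hlt
  have := ModuleCat.subsingleton_ext_of_isWeaklyRegular (ModuleCat.of.{u} R (R ⧸ 𝔪)) rs'
    (ModuleCat.of.{u} R R) (fun x hx => by
      have : x ∈ Module.annihilator R (R ⧸ 𝔪) := by
        rw [Ideal.annihilator_quotient]; exact h.1 x hx
      exact this) h.2.toIsWeaklyRegular rs.length (by exact_mod_cast hlt)
  exact not_subsingleton _ this

/-! ### Polynomial rings, integral extensions and bases. -/

open MvPolynomial

/-- Membership is tested monomial by monomial, and multiplying by `X i` leaves the exponents of the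
variables in `s` unchanged. -/
theorem MvPolynomial.mem_span_X_image_of_X_mul_mem {σ R : Type*} [CommRing R] {s : Set σ} {i : σ}
    (hi : i ∉ s) {p : MvPolynomial σ R}
    (h : X i * p ∈ Ideal.span (X '' s : Set (MvPolynomial σ R))) :
    p ∈ Ideal.span (X '' s : Set (MvPolynomial σ R)) := by
  rw [mem_ideal_span_X_image] at h ⊢
  intro m hm
  obtain ⟨j, hj, hne⟩ := h (Finsupp.single i 1 + m) (by
    simpa [mem_support_iff, coeff_X_mul] using hm)
  refine ⟨j, hj, ?_⟩
  have : i ≠ j := fun h => hi (h ▸ hj)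
  simpa [Finsupp.single_apply, this] using hne

theorem MvPolynomial.isWeaklyRegular_map_X {σ : Type*} (R : Type*) [CommRing R] {l : List σ}
    (hl : l.Nodup) :
    IsWeaklyRegular (MvPolynomial σ R) (l.map (X : σ → MvPolynomial σ R)) := by
  refine ⟨fun i hi => ?_⟩
  have hspan : Ideal.ofList ((l.map (X : σ → MvPolynomial σ R)).take i) =
      Ideal.span (X '' {j | j ∈ l.take i}) := by
    rw [Ideal.ofList, ← List.map_take]
    congr 1
    ext
    simp [-List.map_take]
  rw [isSMulRegular_quotient_iff_mem_of_smul_mem]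
  intro p hp
  simp only [smul_eq_mul, Ideal.mul_top, List.getElem_map, hspan] at hp ⊢
  refine mem_span_X_image_of_X_mul_mem (fun hmem => ?_) hp
  rw [Set.mem_ofPred_eq] at hmem
  simp only [List.mem_take_iff_getElem] at hmem
  obtain ⟨j, hj, hji⟩ := hmem
  rw [hl.getElem_inj_iff] at hji
  omega

theorem MvPolynomial.mem_span_range_X_iff {σ R : Type*} [CommRing R] {p : MvPolynomial σ R} :
    p ∈ Ideal.span (Set.range (X : σ → MvPolynomial σ R)) ↔ constantCoeff p = 0 := by
  rw [← Set.image_univ, mem_ideal_span_X_image, constantCoeff_eq, ← notMem_support_iff]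
  refine ⟨fun h h0 => by simpa using h 0 h0, fun h m hm => ?_⟩
  by_contra! hc
  exact h ((show m = 0 from Finsupp.ext fun i => hc i (Set.mem_univ i)) ▸ hm)

/-- An integral ring extension with a retraction preserves the Krull dimension. -/
theorem ringKrullDim_eq_of_isIntegral_of_surjective {P R : Type*} [CommRing P] [CommRing R]
    [Algebra P R] [Algebra.IsIntegral P R] (f : R →+* P) (hf : Function.Surjective f) :
    ringKrullDim R = ringKrullDim P :=
  le_antisymm
    -- Incomparability: contraction of primes along an integral extension is strictly monotone.
    (Order.krullDim_le_of_strictMono (PrimeSpectrum.comap (algebraMap P R)) fun I J hIJ =>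
      Ideal.IsIntegral.comap_lt_comap (R := P) (I := I.asIdeal) (J := J.asIdeal) hIJ)
    (ringKrullDim_le_of_surjective f hf)

/-- An element lies in the extension of an ideal iff its coordinates lie in the ideal. -/
theorem Module.Basis.mem_ideal_map_iff {ι P R : Type*} [CommRing P] [CommRing R] [Algebra P R]
    (b : Module.Basis ι P R) (J : Ideal P) {a : R} :
    a ∈ J.map (algebraMap P R) ↔ ∀ i, b.repr a i ∈ J := by
  constructor
  · intro ha
    have ha' : a ∈ (J • ⊤ : Submodule P R) := by rwa [Ideal.smul_top_eq_map]
    refine Submodule.smul_induction_on ha' (fun p hp r _ i => ?_) (fun x y hx hy i => ?_)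
    · simpa using J.mul_mem_right _ hp
    · simpa using J.add_mem (hx i) (hy i)
  · intro h
    rw [← b.linearCombination_repr a, Finsupp.linearCombination_apply]
    refine Ideal.sum_mem _ fun i _ => ?_
    simp only [Algebra.smul_def]
    exact Ideal.mul_mem_right _ _ (Ideal.mem_map_of_mem _ (h i))

/-! ### Freeness of the edge ring over the block sums. -/

section CliqueWhiskered

variable {k V : Type*} [Field k] {G : SimpleGraph V} {π : Set (Set V)}

/-- The class of a vertex of `G` in the edge ring of the clique-whiskered graph. -/
noncomputable def vertexClass (k : Type*) [Field k] (G : SimpleGraph V) (π : Set (Set V)) (v : V) :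
    EdgeRing k (cliqueWhiskered G π) :=
  Ideal.Quotient.mk _ (X (Sum.inl v))

/-- The class of a whisker vertex in the edge ring of the clique-whiskered graph. -/
noncomputable def whiskerClass (k : Type*) [Field k] (G : SimpleGraph V) (π : Set (Set V))
    (W : π) : EdgeRing k (cliqueWhiskered G π) :=
  Ideal.Quotient.mk _ (X (Sum.inr W))

theorem vertexClass_mul_vertexClass {u v : V} (h : G.Adj u v) :
    vertexClass k G π u * vertexClass k G π v = 0 := by
  rw [vertexClass, vertexClass, ← map_mul, Ideal.Quotient.eq_zero_iff_mem]
  exact Ideal.subset_span ⟨Sum.inl u, Sum.inl v, h, rfl⟩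

theorem vertexClass_mul_whiskerClass {v : V} {W : π} (h : v ∈ W.1) :
    vertexClass k G π v * whiskerClass k G π W = 0 := by
  rw [vertexClass, whiskerClass, ← map_mul, Ideal.Quotient.eq_zero_iff_mem]
  exact Ideal.subset_span ⟨Sum.inl v, Sum.inr W, h, rfl⟩

theorem IsCliquePartition.exists_mem (hπ : IsCliquePartition G π) (v : V) : ∃ W : π, v ∈ W.1 := by
  obtain ⟨W, ⟨hW, hv⟩, -⟩ := hπ.1.2 v
  exact ⟨⟨W, hW⟩, hv⟩

theorem IsCliquePartition.eq_of_mem (hπ : IsCliquePartition G π) {v : V} {W W' : π}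
    (h : v ∈ W.1) (h' : v ∈ W'.1) : W = W' :=
  Subtype.ext ((hπ.1.2 v).unique ⟨W.2, h⟩ ⟨W'.2, h'⟩)

/-- The block of a clique partition that contains a given vertex. -/
noncomputable def IsCliquePartition.block (hπ : IsCliquePartition G π) (v : V) : π :=
  (hπ.exists_mem v).choose

theorem IsCliquePartition.mem_block (hπ : IsCliquePartition G π) (v : V) : v ∈ (hπ.block v).1 :=
  (hπ.exists_mem v).choose_spec

/-- The residue class of the squarefree monomial with support `S`. -/
noncomputable def vertexMonomial (k : Type*) [Field k] (G : SimpleGraph V) (π : Set (Set V))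
    (S : {S : Finset V // G.IsIndepSet S}) : EdgeRing k (cliqueWhiskered G π) :=
  ∏ v ∈ S.1, vertexClass k G π v

theorem vertexClass_mul_vertexMonomial_of_isIndepSet [DecidableEq V] {v : V}
    {S : {S : Finset V // G.IsIndepSet S}} (h : v ∉ S.1)
    (hS : G.IsIndepSet ((insert v S.1 : Finset V) : Set V)) :
    vertexClass k G π v * vertexMonomial k G π S = vertexMonomial k G π ⟨insert v S.1, hS⟩ := by
  rw [vertexMonomial, vertexMonomial, Finset.prod_insert h]

theorem vertexClass_mul_vertexMonomial_of_not_isIndepSet [DecidableEq V] {v : V}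
    {S : {S : Finset V // G.IsIndepSet S}}
    (hS : ¬ G.IsIndepSet ((insert v S.1 : Finset V) : Set V)) :
    vertexClass k G π v * vertexMonomial k G π S = 0 := by
  have : ∃ u ∈ S.1, G.Adj v u := by
    by_contra! hc
    refine hS ?_
    rw [Finset.coe_insert, SimpleGraph.isIndepSet_iff, Set.pairwise_insert]
    exact ⟨S.2, fun u hu _ => ⟨hc u hu, fun h => hc u hu h.symm⟩⟩
  obtain ⟨u, hu, huv⟩ := this
  rw [vertexMonomial, ← Finset.mul_prod_erase _ _ hu, ← mul_assoc,
    vertexClass_mul_vertexClass huv, zero_mul]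

open scoped Classical in
/-- The projection of the edge ring onto the coordinate ring of the facet spanned by the
independent set `T` and the whisker vertices that are not adjacent to `T`. -/
noncomputable def facetProjection (k : Type*) [Field k] (hπ : IsCliquePartition G π)
    (T : {S : Finset V // G.IsIndepSet S}) :
    EdgeRing k (cliqueWhiskered G π) →ₐ[k] MvPolynomial π k :=
  Ideal.Quotient.liftₐ _ (aeval (Sum.elim (fun v => if v ∈ T.1 then X (hπ.block v) else 0)
    (fun W => if ∃ v ∈ T.1, v ∈ W.1 then 0 else X W))) <| by
    intro a ha
    change a ∈ RingHom.ker (aeval _ : MvPolynomial (V ⊕ π) k →ₐ[k] MvPolynomial π k).toRingHom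
    revert a
    change edgeIdeal k (cliqueWhiskered G π) ≤ _
    rw [edgeIdeal, Ideal.span_le]
    rintro _ ⟨x, y, hxy, rfl⟩
    change aeval _ _ = _
    rw [map_mul, aeval_X, aeval_X]
    -- Every edge has an endpoint that is sent to `0`, by independence of `T` or by the rule for
    -- whiskers.
    rcases x with v | W <;> rcases y with u | W'
    · by_cases hv : v ∈ T.1
      · by_cases hu : u ∈ T.1
        · exact absurd hxy (T.2 hv hu (SimpleGraph.Adj.ne (G := G) hxy))
        · simp [hu]
      · simp [hv]
    · have h : v ∈ W'.1 := hxy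
      by_cases hv : v ∈ T.1
      · simp [if_pos (show ∃ v ∈ T.1, v ∈ W'.1 from ⟨v, hv, h⟩)]
      · simp [hv]
    · have h : u ∈ W.1 := hxy
      by_cases hv : u ∈ T.1
      · simp [if_pos (show ∃ v ∈ T.1, v ∈ W.1 from ⟨u, hv, h⟩)]
      · simp [hv]
    · exact hxy.elim

open scoped Classical in
theorem facetProjection_vertexClass (hπ : IsCliquePartition G π)
    (T : {S : Finset V // G.IsIndepSet S}) (v : V) :
    facetProjection k hπ T (vertexClass k G π v) = if v ∈ T.1 then X (hπ.block v) else 0 :=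
  aeval_X _ _

open scoped Classical in
theorem facetProjection_whiskerClass (hπ : IsCliquePartition G π)
    (T : {S : Finset V // G.IsIndepSet S}) (W : π) :
    facetProjection k hπ T (whiskerClass k G π W) = if ∃ v ∈ T.1, v ∈ W.1 then 0 else X W :=
  aeval_X _ _

variable [Fintype V]

/-- The sum of the variables in the clique `W` and of the whisker vertex attached to it. -/
noncomputable def blockSum (k : Type*) [Field k] (G : SimpleGraph V) (π : Set (Set V)) (W : π) :
    EdgeRing k (cliqueWhiskered G π) :=
  whiskerClass k G π W + ∑ v, W.1.indicator (vertexClass k G π) v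

/-- The edge ring of the clique-whiskered graph as an algebra over the polynomial ring in the
block sums. -/
noncomputable instance blockAlgebra :
    Algebra (MvPolynomial π k) (EdgeRing k (cliqueWhiskered G π)) :=
  (aeval (blockSum k G π)).toAlgebra

theorem algebraMap_X (W : π) :
    algebraMap (MvPolynomial π k) (EdgeRing k (cliqueWhiskered G π)) (X W) = blockSum k G π W :=
  aeval_X _ _

noncomputable instance blockModule :
    Module (MvPolynomial π k) (EdgeRing k (cliqueWhiskered G π)) :=
  blockAlgebra.toModule

instance : IsScalarTower k (MvPolynomial π k) (EdgeRing k (cliqueWhiskered G π)) :=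
  IsScalarTower.of_algebraMap_eq fun c => ((aeval (blockSum k G π)).commutes c).symm

/-- All other summands belong to neighbours of `v`, as `W` is a clique. -/
theorem vertexClass_mul_blockSum (hπ : IsCliquePartition G π) {v : V} {W : π} (h : v ∈ W.1) :
    vertexClass k G π v * blockSum k G π W = vertexClass k G π v * vertexClass k G π v := by
  classical
  rw [blockSum, mul_add, vertexClass_mul_whiskerClass h, zero_add, Finset.mul_sum,
    Finset.sum_eq_single v]
  · rw [Set.indicator_of_mem h]
  · intro u _ huv
    by_cases hu : u ∈ W.1
    · rw [Set.indicator_of_mem hu, vertexClass_mul_vertexClass (hπ.2 _ W.2 h hu huv.symm)]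
    · rw [Set.indicator_of_notMem hu, mul_zero]
  · simp

theorem vertexClass_mul_vertexMonomial_of_mem (hπ : IsCliquePartition G π) {v : V}
    {S : {S : Finset V // G.IsIndepSet S}} (h : v ∈ S.1) :
    vertexClass k G π v * vertexMonomial k G π S =
      (X (hπ.block v) : MvPolynomial π k) • vertexMonomial k G π S := by
  classical
  rw [Algebra.smul_def, algebraMap_X, vertexMonomial, ← Finset.mul_prod_erase _ _ h, ← mul_assoc,
    ← mul_assoc, mul_comm (blockSum _ _ _ _), vertexClass_mul_blockSum hπ (hπ.mem_block v)]

/-- The span contains `1` (from `S = ∅`) and is stable under multiplication by every variable; a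
whisker is its block sum minus vertices. -/
theorem span_vertexMonomial (hπ : IsCliquePartition G π) :
    Submodule.span (MvPolynomial π k) (Set.range (vertexMonomial k G π)) = ⊤ := by
  classical
  set N := Submodule.span (MvPolynomial π k) (Set.range (vertexMonomial k G π)) with hN
  have hv (v : V) (a) (ha : a ∈ N) : vertexClass k G π v * a ∈ N := by
    induction ha using Submodule.span_induction with
    | mem a ha =>
      obtain ⟨S, rfl⟩ := ha
      by_cases hmem : v ∈ S.1
      · rw [vertexClass_mul_vertexMonomial_of_mem hπ hmem]
        exact N.smul_mem _ (Submodule.subset_span ⟨S, rfl⟩)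
      · by_cases hS : G.IsIndepSet ((insert v S.1 : Finset V) : Set V)
        · rw [vertexClass_mul_vertexMonomial_of_isIndepSet hmem hS]
          exact Submodule.subset_span ⟨_, rfl⟩
        · rw [vertexClass_mul_vertexMonomial_of_not_isIndepSet hS]
          exact N.zero_mem
    | zero => simp
    | add x y _ _ hx hy => rw [mul_add]; exact N.add_mem hx hy
    | smul p x _ hx => rw [mul_smul_comm]; exact N.smul_mem _ hx
  have hw (W : π) (a) (ha : a ∈ N) : whiskerClass k G π W * a ∈ N := by
    have : whiskerClass k G π W =
        blockSum k G π W - ∑ v, W.1.indicator (vertexClass k G π) v := by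
      rw [blockSum, add_sub_cancel_right]
    rw [this, sub_mul, ← algebraMap_X, ← Algebra.smul_def, Finset.sum_mul]
    refine N.sub_mem (N.smul_mem _ ha) (N.sum_mem fun v _ => ?_)
    by_cases h : v ∈ W.1
    · rw [Set.indicator_of_mem h]; exact hv v a ha
    · rw [Set.indicator_of_notMem h, zero_mul]; exact N.zero_mem
  rw [eq_top_iff]
  rintro a -
  obtain ⟨p, rfl⟩ := Ideal.Quotient.mk_surjective a
  induction p using MvPolynomial.induction_on with
  | C c =>
    have h1 : (1 : EdgeRing k (cliqueWhiskered G π)) ∈ N :=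
      Submodule.subset_span ⟨⟨∅, by simp⟩, by simp [vertexMonomial]⟩
    have : (Ideal.Quotient.mk (edgeIdeal k (cliqueWhiskered G π)) (C c)) =
        (C c : MvPolynomial π k) • (1 : EdgeRing k (cliqueWhiskered G π)) := by
      rw [Algebra.smul_def, mul_one]
      exact ((aeval (blockSum k G π)).commutes c).symm
    rw [this]
    exact N.smul_mem _ h1
  | add p q hp hq => rw [map_add]; exact N.add_mem hp hq
  | mul_X p i hp =>
    rw [map_mul, mul_comm]
    cases i with
    | inl v => exact hv v _ hp
    | inr W => exact hw W _ hp

/-- `T` meets the clique `W` in at most one vertex: if there is one, it alone survives, and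
otherwise only the whisker does. Hence the projection is a retraction onto `P`. -/
theorem facetProjection_blockSum (hπ : IsCliquePartition G π)
    (T : {S : Finset V // G.IsIndepSet S}) (W : π) :
    facetProjection k hπ T (blockSum k G π W) = X W := by
  classical
  rw [blockSum, map_add, map_sum, facetProjection_whiskerClass]
  split_ifs with h
  · obtain ⟨v, hv, hvW⟩ := h
    rw [zero_add, Finset.sum_eq_single v, Set.indicator_of_mem hvW, facetProjection_vertexClass,
      if_pos hv, hπ.eq_of_mem (hπ.mem_block v) hvW]
    · intro u _ huv
      by_cases hu : u ∈ W.1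
      · rw [Set.indicator_of_mem hu, facetProjection_vertexClass, if_neg]
        exact fun huT => T.2 huT hv huv (hπ.2 _ W.2 hu hvW huv)
      · rw [Set.indicator_of_notMem hu, map_zero]
    · simp
  · rw [add_eq_left]
    refine Finset.sum_eq_zero fun v _ => ?_
    by_cases hv : v ∈ W.1
    · rw [Set.indicator_of_mem hv, facetProjection_vertexClass, if_neg fun hT => h ⟨v, hT, hv⟩]
    · rw [Set.indicator_of_notMem hv, map_zero]

theorem facetProjection_smul (hπ : IsCliquePartition G π) (T : {S : Finset V // G.IsIndepSet S})
    (p : MvPolynomial π k) (a : EdgeRing k (cliqueWhiskered G π)) :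
    facetProjection k hπ T (p • a) = p * facetProjection k hπ T a := by
  rw [Algebra.smul_def, map_mul]
  congr 1
  have : (facetProjection k hπ T).comp (aeval (blockSum k G π)) = AlgHom.id k _ := by
    ext W : 1
    simp [facetProjection_blockSum]
  exact congr($this p)

theorem linearIndependent_vertexMonomial (hπ : IsCliquePartition G π) :
    LinearIndependent (MvPolynomial π k) (vertexMonomial k G π) := by
  classical
  rw [Fintype.linearIndependent_iff]
  intro g hg
  by_contra! hc
  obtain ⟨T₀, hT₀⟩ := hc
  -- The projection for `T` kills `x_S` unless `S ⊆ T`, so for minimal `T` only the term of `T`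
  -- survives, with nonzero image of `x_T`.
  obtain ⟨T, hT⟩ := (Set.toFinite {T | g T ≠ 0}).exists_minimal ⟨T₀, hT₀⟩
  have := congr(facetProjection k hπ T $hg)
  rw [map_sum, map_zero, Finset.sum_eq_single T] at this
  · rw [facetProjection_smul, vertexMonomial, map_prod, mul_eq_zero, or_iff_right hT.1,
      Finset.prod_eq_zero_iff] at this
    obtain ⟨v, hv, h0⟩ := this
    rw [facetProjection_vertexClass, if_pos hv] at h0
    exact X_ne_zero _ h0
  · intro S _ hST
    rw [facetProjection_smul]
    by_cases hS : S ≤ T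
    · by_cases h0 : g S = 0
      · rw [h0, zero_mul]
      · exact absurd (le_antisymm hS (hT.2 h0 hS)) hST
    · obtain ⟨v, hvS, hvT⟩ := Finset.not_subset.1 hS
      rw [vertexMonomial, map_prod, Finset.prod_eq_zero hvS, mul_zero]
      rw [facetProjection_vertexClass, if_neg hvT]
  · simp

/-- The edge ring of the clique-whiskered graph is free over the polynomial ring in the block sums,
with a basis indexed by the independent sets of `G`. -/
noncomputable def vertexBasis (k : Type*) [Field k] (hπ : IsCliquePartition G π) :
    Module.Basis {S : Finset V // G.IsIndepSet S} (MvPolynomial π k)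
      (EdgeRing k (cliqueWhiskered G π)) :=
  .mk (linearIndependent_vertexMonomial hπ) (span_vertexMonomial hπ).ge

theorem vertexBasis_apply (hπ : IsCliquePartition G π) (S : {S : Finset V // G.IsIndepSet S}) :
    vertexBasis k hπ S = vertexMonomial k G π S :=
  Module.Basis.mk_apply _ _ _

end CliqueWhiskered

/-! ### Dimension, the regular sequence and coordinates modulo it. -/

section CliqueWhiskered

variable {k V : Type*} [Field k] {G : SimpleGraph V} {π : Set (Set V)}

theorem vertexClass_mem_edgeRingMaximalIdeal (v : V) :
    vertexClass k G π v ∈ edgeRingMaximalIdeal k (cliqueWhiskered G π) :=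
  Ideal.subset_span ⟨Sum.inl v, rfl⟩

theorem whiskerClass_mem_edgeRingMaximalIdeal (W : π) :
    whiskerClass k G π W ∈ edgeRingMaximalIdeal k (cliqueWhiskered G π) :=
  Ideal.subset_span ⟨Sum.inr W, rfl⟩

theorem edgeRingMaximalIdeal_ne_top {V : Type*} (G : SimpleGraph V) :
    edgeRingMaximalIdeal k G ≠ ⊤ := by
  let f : EdgeRing k G →ₐ[k] k := Ideal.Quotient.liftₐ _ (aeval fun _ => (0 : k)) <| by
    intro a ha
    change a ∈ RingHom.ker (aeval _ : MvPolynomial V k →ₐ[k] k).toRingHom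
    revert a
    change edgeIdeal k G ≤ _
    rw [edgeIdeal, Ideal.span_le]
    rintro _ ⟨x, y, -, rfl⟩
    change aeval _ _ = _
    simp
  have hle : edgeRingMaximalIdeal k G ≤ RingHom.ker f := by
    rw [edgeRingMaximalIdeal, Ideal.span_le]
    rintro _ ⟨v, rfl⟩
    exact aeval_X _ _
  intro h
  exact RingHom.ker_ne_top f.toRingHom (top_le_iff.1 (h ▸ hle))

variable [Fintype V]

theorem blockSum_mem_edgeRingMaximalIdeal (W : π) :
    blockSum k G π W ∈ edgeRingMaximalIdeal k (cliqueWhiskered G π) := by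
  refine Ideal.add_mem _ (whiskerClass_mem_edgeRingMaximalIdeal W) (Ideal.sum_mem _ fun v _ => ?_)
  by_cases h : v ∈ W.1
  · rw [Set.indicator_of_mem h]; exact vertexClass_mem_edgeRingMaximalIdeal v
  · rw [Set.indicator_of_notMem h]; exact Ideal.zero_mem _

theorem ringKrullDim_edgeRing_cliqueWhiskered (hπ : IsCliquePartition G π) :
    ringKrullDim (EdgeRing k (cliqueWhiskered G π)) = Nat.card π := by
  have : Module.Finite (MvPolynomial π k) (EdgeRing k (cliqueWhiskered G π)) :=
    .of_basis (vertexBasis k hπ)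
  have : Algebra.IsIntegral (MvPolynomial π k) (EdgeRing k (cliqueWhiskered G π)) := inferInstance
  rw [ringKrullDim_eq_of_isIntegral_of_surjective (P := MvPolynomial π k)
    -- For `T = ∅` the facet consists of all whiskers.
    (facetProjection k hπ ⟨∅, by simp⟩).toRingHom (fun p => ?_),
    MvPolynomial.ringKrullDim_of_isNoetherianRing, ringKrullDim_eq_zero_of_field, zero_add]
  refine ⟨p • 1, ?_⟩
  change facetProjection k hπ _ _ = p
  rw [facetProjection_smul, map_one, mul_one]

variable [Fintype π]

/-- The block sums, as a list. -/
noncomputable def blockSumList (k : Type*) [Field k] (G : SimpleGraph V) (π : Set (Set V))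
    [Fintype π] : List (EdgeRing k (cliqueWhiskered G π)) :=
  (Finset.univ : Finset π).toList.map (blockSum k G π)

theorem length_blockSumList : (blockSumList k G π).length = Nat.card π := by
  simp [blockSumList]

theorem blockSumList_eq_map :
    blockSumList k G π = ((Finset.univ : Finset π).toList.map
      (X : π → MvPolynomial π k)).map (algebraMap _ _) := by
  rw [List.map_map]
  exact List.map_congr_left fun W _ => (algebraMap_X W).symm

theorem mem_edgeRingMaximalIdeal_of_mem_blockSumList {a : EdgeRing k (cliqueWhiskered G π)}
    (ha : a ∈ blockSumList k G π) : a ∈ edgeRingMaximalIdeal k (cliqueWhiskered G π) := by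
  obtain ⟨W, -, rfl⟩ := List.mem_map.1 ha
  exact blockSum_mem_edgeRingMaximalIdeal W

theorem ofList_blockSumList_le :
    Ideal.ofList (blockSumList k G π) ≤ edgeRingMaximalIdeal k (cliqueWhiskered G π) :=
  Ideal.span_le.2 fun _ ha => mem_edgeRingMaximalIdeal_of_mem_blockSumList ha

/-- The variables of `P` form a weakly regular sequence, and this passes to the flat `P`-algebra
`R`. -/
theorem isRegular_blockSumList (hπ : IsCliquePartition G π) :
    IsRegular (EdgeRing k (cliqueWhiskered G π)) (blockSumList k G π) := by
  have : Module.Free (MvPolynomial π k) (EdgeRing k (cliqueWhiskered G π)) :=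
    .of_basis (vertexBasis k hπ)
  refine ⟨?_, fun h => ?_⟩
  · rw [blockSumList_eq_map]
    exact (isWeaklyRegular_map_X k (Finset.nodup_toList _)).of_flat
  · rw [smul_eq_mul, Ideal.mul_top] at h
    exact edgeRingMaximalIdeal_ne_top _ (top_le_iff.1 (h ▸ ofList_blockSumList_le))

/-- The coordinates modulo the block sums. -/
noncomputable def residueCoord (k : Type*) [Field k] (hπ : IsCliquePartition G π)
    (S : {S : Finset V // G.IsIndepSet S}) (a : EdgeRing k (cliqueWhiskered G π)) : k :=
  constantCoeff ((vertexBasis k hπ).repr a S)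

theorem mem_ofList_blockSumList_iff (hπ : IsCliquePartition G π)
    {a : EdgeRing k (cliqueWhiskered G π)} :
    a ∈ Ideal.ofList (blockSumList k G π) ↔ ∀ S, residueCoord k hπ S a = 0 := by
  have : Ideal.ofList (blockSumList k G π) =
      (Ideal.span (Set.range (X : π → MvPolynomial π k))).map
        (algebraMap (MvPolynomial π k) (EdgeRing k (cliqueWhiskered G π))) := by
    rw [blockSumList_eq_map, ← Ideal.map_ofList, Ideal.ofList]
    congr 2
    ext
    simp
  rw [this, (vertexBasis k hπ).mem_ideal_map_iff]
  exact forall_congr' fun S => mem_span_range_X_iff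

omit [Fintype π] in
theorem residueCoord_add (hπ : IsCliquePartition G π) (S) (a b) :
    residueCoord k hπ S (a + b) = residueCoord k hπ S a + residueCoord k hπ S b := by
  simp [residueCoord]

omit [Fintype π] in
theorem residueCoord_smul (hπ : IsCliquePartition G π) (S) (p : MvPolynomial π k) (a) :
    residueCoord k hπ S (p • a) = constantCoeff p * residueCoord k hπ S a := by
  simp [residueCoord]

omit [Fintype π] in
theorem residueCoord_vertexMonomial [DecidableEq V] (hπ : IsCliquePartition G π) (S T) :
    residueCoord k hπ S (vertexMonomial k G π T) = if T = S then 1 else 0 := by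
  rw [residueCoord, ← vertexBasis_apply hπ, Module.Basis.repr_self, Finsupp.single_apply]
  split_ifs <;> simp

omit [Fintype π] in
theorem induction_on_vertexMonomial (hπ : IsCliquePartition G π)
    {p : EdgeRing k (cliqueWhiskered G π) → Prop} (a : EdgeRing k (cliqueWhiskered G π))
    (mem : ∀ S, p (vertexMonomial k G π S)) (zero : p 0)
    (add : ∀ a b, p a → p b → p (a + b)) (smul : ∀ (f : MvPolynomial π k) a, p a → p (f • a)) :
    p a := by
  have ha : a ∈ Submodule.span (MvPolynomial π k) (Set.range (vertexMonomial k G π)) := by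
    rw [span_vertexMonomial hπ]; trivial
  induction ha using Submodule.span_induction with
  | mem a ha => obtain ⟨S, rfl⟩ := ha; exact mem S
  | zero => exact zero
  | add a b _ _ ha hb => exact add a b ha hb
  | smul f a _ ha => exact smul f a ha

omit [Fintype π] in
theorem residueCoord_zero (hπ : IsCliquePartition G π) (S) :
    residueCoord k hπ S (0 : EdgeRing k (cliqueWhiskered G π)) = 0 := by
  simp [residueCoord]

-- Modulo the block sums, `x_v x_S` is `x_{S ∪ {v}}` if `v ∉ S` and the union is independent, and
-- `0` otherwise; thus only `S = T \ {v}` contributes at `T`.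
omit [Fintype π] in
theorem residueCoord_vertexClass_mul [DecidableEq V] (hπ : IsCliquePartition G π) (v : V)
    (T : {S : Finset V // G.IsIndepSet S}) (a) :
    residueCoord k hπ T (vertexClass k G π v * a) =
      if v ∈ T.1 then residueCoord k hπ ⟨T.1.erase v, T.2.mono (by simp)⟩ a else 0 := by
  induction a using induction_on_vertexMonomial hπ with
  | zero => simp [residueCoord_zero]
  | add a b ha hb =>
    rw [mul_add, residueCoord_add, ha, hb, residueCoord_add]
    split_ifs <;> simp
  | smul f a ha =>
    rw [mul_smul_comm, residueCoord_smul, ha, residueCoord_smul]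
    split_ifs <;> simp
  | mem S =>
    rw [residueCoord_vertexMonomial]
    by_cases hv : v ∈ S.1
    -- The left side carries a factor from `P` without constant term; on the right `S` contains `v`
    -- and `T.erase v` does not.
    · rw [vertexClass_mul_vertexMonomial_of_mem hπ hv, residueCoord_smul, constantCoeff_X, zero_mul,
        if_neg (c := S = _), ite_self]
      rintro rfl
      simp at hv
    · by_cases hS : G.IsIndepSet ((insert v S.1 : Finset V) : Set V)
      · rw [vertexClass_mul_vertexMonomial_of_isIndepSet hv hS, residueCoord_vertexMonomial]
        by_cases hT : v ∈ T.1
        · rw [if_pos hT]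
          congr 1
          simp only [Subtype.ext_iff, eq_iff_iff]
          exact ⟨fun h => by rw [← h, Finset.erase_insert hv],
            fun h => by rw [h, Finset.insert_erase hT]⟩
        · rw [if_neg hT, if_neg]
          rintro rfl
          simp at hT
      · rw [vertexClass_mul_vertexMonomial_of_not_isIndepSet hS, residueCoord_zero]
        split_ifs with hT h
        · subst h
          rw [Finset.insert_erase hT] at hS
          exact absurd T.2 hS
        · rfl
        · rfl

/-- Multiplication by the maximal ideal kills `a` modulo the block sums iff `a` has no coordinates
at non-maximal independent sets. -/
theorem forall_mul_mem_ofList_blockSumList_iff (hπ : IsCliquePartition G π)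
    (a : EdgeRing k (cliqueWhiskered G π)) :
    (∀ x ∈ edgeRingMaximalIdeal k (cliqueWhiskered G π),
        x * a ∈ Ideal.ofList (blockSumList k G π)) ↔
      ∀ S, ¬ IsMax S → residueCoord k hπ S a = 0 := by
  classical
  constructor
  · intro h S hS
    -- Some vertex `v` extends `S` independently; the coordinate of `x_v a` at `S ∪ {v}` is that of
    -- `a` at `S`.
    obtain ⟨T, hST⟩ := not_isMax_iff.1 hS
    obtain ⟨v, hvT, hvS⟩ := Finset.exists_of_ssubset hST
    have hins : G.IsIndepSet ((insert v S.1 : Finset V) : Set V) :=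
      T.2.mono (Finset.insert_subset hvT hST.le)
    have := (mem_ofList_blockSumList_iff hπ).1 (h _ (vertexClass_mem_edgeRingMaximalIdeal v))
      ⟨_, hins⟩
    rw [residueCoord_vertexClass_mul, if_pos (by simp)] at this
    simpa [Finset.erase_insert hvS] using this
  · intro h
    have hv (v : V) : vertexClass k G π v * a ∈ Ideal.ofList (blockSumList k G π) := by
      rw [mem_ofList_blockSumList_iff hπ]
      intro T
      rw [residueCoord_vertexClass_mul]
      split_ifs with hT
      · refine h _ (not_isMax_iff.2 ⟨T, ?_⟩)
        exact Finset.erase_ssubset hT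
      · rfl
    -- Modulo the block sums a whisker is minus the sum of the vertices of its block.
    have hw (W : π) : whiskerClass k G π W * a ∈ Ideal.ofList (blockSumList k G π) := by
      have : whiskerClass k G π W =
          blockSum k G π W - ∑ v, W.1.indicator (vertexClass k G π) v := by
        rw [blockSum, add_sub_cancel_right]
      rw [this, sub_mul, Finset.sum_mul]
      refine Ideal.sub_mem _ (Ideal.mul_mem_right _ _ (Ideal.subset_span ?_))
        (Ideal.sum_mem _ fun v _ => ?_)
      · exact List.mem_map.2 ⟨W, by simp, rfl⟩
      · by_cases h : v ∈ W.1
        · rw [Set.indicator_of_mem h]; exact hv v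
        · rw [Set.indicator_of_notMem h, zero_mul]; exact Ideal.zero_mem _
    intro x hx
    induction hx using Submodule.span_induction with
    | mem x hx =>
      obtain ⟨v | W, rfl⟩ := hx
      · exact hv v
      · exact hw W
    | zero => rw [zero_mul]; exact Ideal.zero_mem _
    | add x y _ _ hx hy => rw [add_mul]; exact Ideal.add_mem _ hx hy
    | smul r x _ hx => rw [smul_eq_mul, mul_assoc]; exact Ideal.mul_mem_left _ _ hx

/-- The element of the edge ring with prescribed coordinates at the maximal independent sets. -/
noncomputable def socleLift (k : Type*) [Field k] (G : SimpleGraph V) (π : Set (Set V)) :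
    ({S : {S : Finset V // G.IsIndepSet S} // IsMax S} → k) →ₗ[k]
      EdgeRing k (cliqueWhiskered G π) := by
  classical exact Fintype.linearCombination k fun S => vertexMonomial k G π S.1

omit [Fintype π] in
theorem residueCoord_socleLift (hπ : IsCliquePartition G π)
    (c : {S : {S : Finset V // G.IsIndepSet S} // IsMax S} → k) (S) [Decidable (IsMax S)] :
    residueCoord k hπ S (socleLift k G π c) = if h : IsMax S then c ⟨S, h⟩ else 0 := by
  classical
  have hsum (s : Finset {S : {S : Finset V // G.IsIndepSet S} // IsMax S}) :
      residueCoord k hπ S (∑ T ∈ s, c T • vertexMonomial k G π T.1) =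
        ∑ T ∈ s, if T.1 = S then c T else 0 := by
    induction s using Finset.induction_on with
    | empty => simp [residueCoord_zero]
    | insert T s hT ih =>
      rw [Finset.sum_insert hT, Finset.sum_insert hT, residueCoord_add, ih,
        ← algebraMap_smul (MvPolynomial π k) (c T), residueCoord_smul, residueCoord_vertexMonomial,
        algebraMap_eq, constantCoeff_C, mul_ite, mul_one, mul_zero]
  rw [socleLift, Fintype.linearCombination_apply, hsum]
  split_ifs with h
  · rw [Finset.sum_eq_single ⟨S, h⟩]
    · simp
    · intro T _ hT
      rw [if_neg fun h' => hT (Subtype.ext h')]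
    · simp
  · exact Finset.sum_eq_zero fun T _ => if_neg fun h' : T.1 = S => h (h' ▸ T.2)

end CliqueWhiskered

/-! ### Homomorphisms out of a cyclic module. -/

section Socle

variable {R : Type u} [CommRing R]

/-- The homomorphism `R ⧸ I → M` determined by an element of `M` killed by `I`. -/
noncomputable def ModuleCat.homOfQuotient {I : Ideal R} {M : Type u} [AddCommGroup M] [Module R M]
    (z : M) (hz : ∀ x ∈ I, x • z = 0) : ModuleCat.of.{u} R (R ⧸ I) ⟶ ModuleCat.of.{u} R M :=
  ModuleCat.ofHom (Submodule.liftQ I (LinearMap.toSpanSingleton R M z) fun x hx => hz x hx)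

theorem ModuleCat.homOfQuotient_one {I : Ideal R} {M : Type u} [AddCommGroup M] [Module R M]
    (z : M) (hz : ∀ x ∈ I, x • z = 0) :
    (ModuleCat.homOfQuotient z hz).hom (Ideal.Quotient.mk I 1) = z :=
  one_smul R z

theorem ModuleCat.hom_ext_one {I : Ideal R} {M : Type u} [AddCommGroup M] [Module R M]
    {f g : ModuleCat.of.{u} R (R ⧸ I) ⟶ ModuleCat.of.{u} R M}
    (h : f.hom (Ideal.Quotient.mk I 1) = g.hom (Ideal.Quotient.mk I 1)) : f = g := by
  refine ModuleCat.hom_ext (LinearMap.ext fun x => ?_)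
  obtain ⟨r, rfl⟩ := Ideal.Quotient.mk_surjective x
  have : Ideal.Quotient.mk I r = r • Ideal.Quotient.mk I 1 := by
    rw [← Ideal.Quotient.mk_eq_mk, ← Ideal.Quotient.mk_eq_mk, ← Submodule.Quotient.mk_smul,
      smul_eq_mul, mul_one]
  rw [this, map_smul, map_smul, h]

/-- Homomorphisms from `R ⧸ I` to `M` are the elements of `M` killed by `I`. -/
theorem ModuleCat.finrank_hom_quotient (k : Type*) [Field k] [Algebra k R] (I : Ideal R)
    (M : ModuleCat.{u} R) {W : Type*} [AddCommGroup W] [Module k W] (φ : W →+ M)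
    (hsmul : ∀ (c : k) (w : W), φ (c • w) = algebraMap k R c • φ w) (hinj : Function.Injective φ)
    (hrange : ∀ z : M, z ∈ Set.range φ ↔ ∀ x ∈ I, x • z = 0) :
    Module.finrank k (ModuleCat.of.{u} R (R ⧸ I) ⟶ M) = Module.finrank k W := by
  have hz (w : W) := (hrange (φ w)).1 ⟨w, rfl⟩
  let Ψ : W →ₗ[k] (ModuleCat.of.{u} R (R ⧸ I) ⟶ M) :=
    { toFun w := ModuleCat.homOfQuotient (φ w) (hz w)
      map_add' v w := by
        apply ModuleCat.hom_ext_one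
        rw [ModuleCat.homOfQuotient_one, map_add, ModuleCat.hom_add, LinearMap.add_apply,
          ModuleCat.homOfQuotient_one, ModuleCat.homOfQuotient_one]
      map_smul' c w := by
        apply ModuleCat.hom_ext_one
        rw [ModuleCat.homOfQuotient_one, hsmul, RingHom.id_apply]
        change _ = algebraMap k R c •
          (ModuleCat.homOfQuotient (φ w) (hz w)).hom (Ideal.Quotient.mk I 1)
        rw [ModuleCat.homOfQuotient_one] }
  have hΨ (w) : (Ψ w).hom (Ideal.Quotient.mk I 1) = φ w := ModuleCat.homOfQuotient_one _ _
  refine (LinearEquiv.ofBijective Ψ ⟨fun v w h => hinj ?_, fun f => ?_⟩).finrank_eq.symm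
  · rw [← hΨ, ← hΨ, h]
  · obtain ⟨w, hw⟩ := (hrange (f.hom (Ideal.Quotient.mk I 1))).2 fun x hx => by
      have : x • Ideal.Quotient.mk I 1 = 0 := by
        rw [← Ideal.Quotient.mk_eq_mk, ← Submodule.Quotient.mk_smul, smul_eq_mul, mul_one]
        exact (Submodule.Quotient.mk_eq_zero _).2 hx
      rw [← map_smul, this, map_zero]
    exact ⟨w, ModuleCat.hom_ext_one ((hΨ w).trans hw)⟩

end Socle

/-! ### The socle modulo the block sums, and vertex covers. -/

section CliqueWhiskered

variable {k V : Type*} [Field k] {G : SimpleGraph V} {π : Set (Set V)} [Fintype V] [Fintype π]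

theorem mem_ofList_blockSumList_smul_top {a : EdgeRing k (cliqueWhiskered G π)} :
    a ∈ (Ideal.ofList (blockSumList k G π) • ⊤ :
        Submodule (EdgeRing k (cliqueWhiskered G π)) (EdgeRing k (cliqueWhiskered G π))) ↔
      a ∈ Ideal.ofList (blockSumList k G π) := by
  rw [smul_eq_mul, Ideal.mul_top]

/-- `socleLift` modulo the block sums. -/
noncomputable def socleMap (k : Type*) [Field k] (G : SimpleGraph V) (π : Set (Set V))
    [Fintype π] : ({S : {S : Finset V // G.IsIndepSet S} // IsMax S} → k) →+
      EdgeRing k (cliqueWhiskered G π) ⧸ (Ideal.ofList (blockSumList k G π) • ⊤ :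
        Submodule (EdgeRing k (cliqueWhiskered G π)) (EdgeRing k (cliqueWhiskered G π))) :=
  (Submodule.mkQ _).toAddMonoidHom.comp (socleLift k G π).toAddMonoidHom

theorem socleMap_apply (c) :
    socleMap k G π c = Submodule.Quotient.mk (socleLift k G π c) :=
  rfl

theorem socleMap_smul (c : k) (w) :
    socleMap k G π (c • w) =
      algebraMap k (EdgeRing k (cliqueWhiskered G π)) c • socleMap k G π w := by
  rw [socleMap_apply, socleMap_apply, map_smul, ← Submodule.Quotient.mk_smul, algebraMap_smul]

theorem socleMap_injective (hπ : IsCliquePartition G π) :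
    Function.Injective (socleMap k G π) := by
  classical
  rw [injective_iff_map_eq_zero]
  intro c hc
  rw [socleMap_apply, Submodule.Quotient.mk_eq_zero, mem_ofList_blockSumList_smul_top,
    mem_ofList_blockSumList_iff hπ] at hc
  funext S
  have := hc S.1
  rwa [residueCoord_socleLift, dif_pos S.2] at this

theorem mem_range_socleMap_iff (hπ : IsCliquePartition G π) (z) :
    z ∈ Set.range (socleMap k G π) ↔
      ∀ x ∈ edgeRingMaximalIdeal k (cliqueWhiskered G π), x • z = 0 := by
  classical
  obtain ⟨a, rfl⟩ := Submodule.Quotient.mk_surjective _ z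
  have hiff : (∀ x ∈ edgeRingMaximalIdeal k (cliqueWhiskered G π),
        x • (Submodule.Quotient.mk a : EdgeRing k (cliqueWhiskered G π) ⧸
          (Ideal.ofList (blockSumList k G π) • ⊤ : Submodule (EdgeRing k (cliqueWhiskered G π))
            (EdgeRing k (cliqueWhiskered G π)))) = 0) ↔
      ∀ S, ¬ IsMax S → residueCoord k hπ S a = 0 := by
    rw [← forall_mul_mem_ofList_blockSumList_iff hπ]
    refine forall₂_congr fun x _ => ?_
    rw [← Submodule.Quotient.mk_smul, Submodule.Quotient.mk_eq_zero,
      mem_ofList_blockSumList_smul_top, smul_eq_mul]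
  rw [hiff]
  have hadd (c S) : residueCoord k hπ S a = residueCoord k hπ S (socleLift k G π c) -
      residueCoord k hπ S (socleLift k G π c - a) := by
    have := residueCoord_add hπ S (socleLift k G π c - a) a
    rw [sub_add_cancel] at this
    rw [this, add_sub_cancel_left]
  constructor
  · rintro ⟨c, hc⟩ S hS
    rw [socleMap_apply, Submodule.Quotient.eq, mem_ofList_blockSumList_smul_top,
      mem_ofList_blockSumList_iff hπ] at hc
    rw [hadd c, hc, residueCoord_socleLift, dif_neg hS, sub_zero]
  · intro h
    -- The witness keeps the coordinates of `a` at maximal sets; all others vanish by `h`.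
    refine ⟨fun S => residueCoord k hπ S.1 a, ?_⟩
    rw [socleMap_apply, Submodule.Quotient.eq, mem_ofList_blockSumList_smul_top,
      mem_ofList_blockSumList_iff hπ]
    intro S
    have := hadd (fun S => residueCoord k hπ S.1 a) S
    rw [residueCoord_socleLift] at this
    split_ifs at this with hS
    · exact sub_eq_self.1 this.symm
    · simpa [h S hS] using this

-- Complementation reverses inclusion and exchanges independent sets with vertex covers.
omit [Fintype π] in
theorem card_isMax_isIndepSet (G : SimpleGraph V) :
    Nat.card {S : {S : Finset V // G.IsIndepSet S} // IsMax S} =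
      {C : Set V | Minimal G.IsVertexCover C}.ncard := by
  classical
  rw [← Nat.card_coe_set_eq]
  refine Nat.card_congr (Equiv.ofBijective (fun S => ⟨(S.1.1 : Set V)ᶜ, ?_, ?_⟩) ⟨?_, ?_⟩)
  · exact SimpleGraph.isVertexCover_compl.2 S.1.2
  · intro C hC hCS
    rw [← SimpleGraph.isIndepSet_compl_iff_isVertexCover] at hC
    have := @S.2 ⟨Cᶜ.toFinset, by simpa using hC⟩ (by
      change S.1.1 ⊆ _
      intro v hv
      simp only [Set.mem_toFinset]
      exact fun hvC => hCS hvC hv)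
    intro v hv
    by_contra hvC
    have hv' : v ∈ Cᶜ.toFinset := by simpa using hvC
    exact hv (this hv')
  · intro S T h
    exact Subtype.ext (Subtype.ext (Finset.coe_injective (compl_injective congr(($h).1))))
  · rintro ⟨C, hC, hmin⟩
    have hC' := SimpleGraph.isIndepSet_compl_iff_isVertexCover.2 hC
    refine ⟨⟨⟨Cᶜ.toFinset, by simpa using hC'⟩, fun T hT => ?_⟩, Subtype.ext (by simp)⟩
    change T.1 ⊆ Cᶜ.toFinset
    have hsub : Cᶜ.toFinset ⊆ T.1 := hT
    intro v hv
    rw [Set.mem_toFinset]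
    intro hvC
    refine hmin (SimpleGraph.isVertexCover_compl.2 T.2) (fun u hu => ?_) hvC hv
    by_contra huC
    exact hu (hsub (by simpa using huC))

/-- Makes the socle nonzero, so that the block sums form a longest regular sequence. -/
theorem nonempty_isMax_isIndepSet (G : SimpleGraph V) :
    Nonempty {S : {S : Finset V // G.IsIndepSet S} // IsMax S} := by
  obtain ⟨S, -, hS⟩ := Finite.exists_le_maximal
    (p := fun _ : {S : Finset V // G.IsIndepSet S} => True) (a := ⟨∅, by simp⟩) trivial
  exact ⟨S, fun T hT => hS.2 trivial hT⟩

end CliqueWhiskered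

theorem mainTheorem8 {k V : Type*} [Field k] [Finite V] (G : SimpleGraph V) (π : Set (Set V))
    (hπ : IsCliquePartition G π) :
    IsGradedCohenMacaulay (edgeRingMaximalIdeal k (cliqueWhiskered G π)) ∧
      cohenMacaulayType k (edgeRingMaximalIdeal k (cliqueWhiskered G π)) =
        {C : Set V | Minimal G.IsVertexCover C}.ncard := by
  cases nonempty_fintype V
  cases nonempty_fintype π
  have hann : ∀ x ∈ blockSumList k G π, x ∈ Module.annihilator (EdgeRing k (cliqueWhiskered G π))
      (EdgeRing k (cliqueWhiskered G π) ⧸ edgeRingMaximalIdeal k (cliqueWhiskered G π)) := by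
    intro x hx
    rw [Ideal.annihilator_quotient]
    exact mem_edgeRingMaximalIdeal_of_mem_blockSumList hx
  have hreg := isRegular_blockSumList (k := k) hπ
  -- `Ext` in degree `|π|` has the dimension of the socle, which `socleMap` parametrizes by
  -- functions on maximal independent sets.
  have hrank := (ModuleCat.finrank_ext_length_of_isWeaklyRegular k
    (ModuleCat.of (EdgeRing k (cliqueWhiskered G π))
      (EdgeRing k (cliqueWhiskered G π) ⧸ edgeRingMaximalIdeal k (cliqueWhiskered G π)))
    (blockSumList k G π) (ModuleCat.of _ (EdgeRing k (cliqueWhiskered G π))) hann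
    hreg.toIsWeaklyRegular).trans (ModuleCat.finrank_hom_quotient k _ _ (socleMap k G π)
      socleMap_smul (socleMap_injective hπ) (mem_range_socleMap_iff hπ))
  classical
  rw [Module.finrank_fintype_fun_eq_card, ← Nat.card_eq_fintype_card] at hrank
  have := nonempty_isMax_isIndepSet G
  have hext := Module.nontrivial_of_finrank_pos (R := k) (hrank ▸ Nat.card_pos)
  have hdepth := depthAt_eq_length _ _ (fun _ => mem_edgeRingMaximalIdeal_of_mem_blockSumList)
    hreg hext
  constructor
  · rw [IsGradedCohenMacaulay, hdepth, length_blockSumList,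
      ringKrullDim_edgeRing_cliqueWhiskered hπ]
    rfl
  · rw [cohenMacaulayType, hdepth, ENat.toNat_natCast, hrank, card_isMax_isIndepSet]
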